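/- Let $X$ be a set. A finite weighted $X$-digraph $\Gamma=(V,E,\mu,\gamma)$ is a finite directed multigraph with labels $\mu:E\to X^{\pm}$ and weights $\gamma:E\to\mathbb Z$, given together with a modulus $N\in\mathbb N\cup\{\infty\}$. It is \emph{folded} if no two distinct edges have the same origin and the same label. A \emph{fold} takes two distinct edges $e_1=u\xrightarrow{x,a}v_1$ and $e_2=u\xrightarrow{x,b}v_2$. If $v_1=v_2$, it removes $e_2$ and, when $a\not\equiv b \pmod N$, replaces $N$ by $\gcd(N,b-a)$. If $v_1\neq v_2$, it either shifts $v_1$ by $a-b$ or shifts $v_2$ by $b-a$, then identifies $v_1$ with $v_2$ and removes $e_2$; here shifting $v$ by $c$ adds $c$ to the weights of the non-loop edges leaving $v$ and subtracts $c$ from the weights of the non-loop edges entering $v$. The \emph{folding procedure} performs folds, in any order, until none is possible, and does so without rewriting the edges. It keeps the classes of identified vertices as union--find trees (with path compression and linking by rank) in which each vertex $v$ has a parent $p(v)$ and a shift value $\delta(v)$. The total shift is $\Delta(v)=0$ if $p(v)=v$, and $\Delta(v)=\delta(v)+\Delta(p(v))$ otherwise. A stored edge $v\xrightarrow{x,a}w$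 represents the edge of weight $a+\Delta(v)-\Delta(w)$ between the roots of the trees of $v$ and $w$. To fold two edges, the procedure finds the roots and the total shifts of their endpoints and computes the two weights; then it either updates $N$, or makes one root $r$ a child of the other and stores the required shift as $\delta(r)$. At the end it computes the endpoints and weights of all remaining edges and outputs the resulting graph. All additions and subtractions (of weights, of shift values and of ranks) are counted; computing a $\gcd$ counts as no addition. Let $\log^*(n)$ denote the inverse Ackermann function $\min\{k\ge 1 : n\le A(k,k)\}$. Then there is an absolute constant $K$ such that for every finite weighted $X$-digraph $\Gamma$ (with any set $X$ and any modulus) the folding procedure has a complete execution on $\Gamma$, and every complete execution outputs a folded graph that is obtained from $\Gamma$ by a finite sequence of folds, and performs at most $K\,(|V|+|E|)\log^*(|V|)$ additions. In particular, if $|E|\le c\,|V|$, then it performs at most $K(c+1)\,|V|\log^*(|V|)$ additions; that is, $O(|V|\log^*(|V|))$ additions for graphs whose number of edges is linear in the number of vertices. -/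

import Mathlib

/-! ### Weighted `X`-digraphs and the folding operation -/

/-- An edge `origin --(label, weight)--> terminus`. Labels are taken in `X^±`, represented by
`X × Bool`. -/
structure WEdge (V : Type*) (X : Type*) where
  origin : V
  terminus : V
  label : X × Bool
  weight : ℤ

/-- A finite weighted `X`-digraph together with the modulus `N` that folding keeps track of.
Edges form a multiset, so parallel edges (even with equal label and weight) are allowed.
`modulus = 0` stands for `N = ∞`, i.e. congruence modulo `N` is then equality. -/
@[ext]
structure WDigraph (V : Type*) (X : Type*) where
  verts : Finset V
  edges : Multiset (WEdge V X)
  modulus : ℕ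

namespace WDigraph

variable {V X : Type*}

/-- All endpoints of edges are vertices. -/
def WellFormed (Γ : WDigraph V X) : Prop :=
  ∀ e ∈ Γ.edges, e.origin ∈ Γ.verts ∧ e.terminus ∈ Γ.verts

/-- No two edges have the same origin and the same label. -/
def IsFolded (Γ : WDigraph V X) : Prop :=
  ∀ e₁ e₂ rest, Γ.edges = e₁ ::ₘ e₂ ::ₘ rest → e₁.origin = e₂.origin → e₁.label ≠ e₂.label

variable [DecidableEq V]

/-- Weight-shift at `v`: weights of non-loop edges leaving `v` are increased by `c`, weights of
non-loop edges entering `v` are decreased by `c`. -/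
def shift (Γ : WDigraph V X) (v : V) (c : ℤ) : WDigraph V X :=
  { Γ with
    edges := Γ.edges.map fun e =>
      if e.origin = v ∧ e.terminus ≠ v then { e with weight := e.weight + c }
      else if e.terminus = v ∧ e.origin ≠ v then { e with weight := e.weight - c }
      else e }

/-- Identification of the vertices `v` and `w`; the resulting vertex is named `w`. -/
def identify (Γ : WDigraph V X) (v w : V) : WDigraph V X :=
  { Γ with
    verts := Γ.verts.erase v
    edges := Γ.edges.map fun e =>
      { e with
        origin := if e.origin = v then w else e.origin
        terminus := if e.terminus = v then w else e.terminus } }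

/-- One fold of two distinct edges `e₁ = u --(x,a)--> v₁` and `e₂ = u --(x,b)--> v₂`; the edge
`e₂` is removed. If `v₁ ≠ v₂`, then one of the vertices `v₁`, `v₂` is shifted, so that the two
edges get equal weights, and it is identified with the other one. -/
inductive FoldStep (Γ : WDigraph V X) : WDigraph V X → Prop
  | congr (e₁ e₂ : WEdge V X) (rest : Multiset (WEdge V X))
      (hΓ : Γ.edges = e₁ ::ₘ e₂ ::ₘ rest)
      (ho : e₁.origin = e₂.origin) (hl : e₁.label = e₂.label)
      (ht : e₁.terminus = e₂.terminus)
      (hw : e₁.weight ≡ e₂.weight [ZMOD Γ.modulus]) :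
      FoldStep Γ { Γ with edges := e₁ ::ₘ rest }
  | not_congr (e₁ e₂ : WEdge V X) (rest : Multiset (WEdge V X))
      (hΓ : Γ.edges = e₁ ::ₘ e₂ ::ₘ rest)
      (ho : e₁.origin = e₂.origin) (hl : e₁.label = e₂.label)
      (ht : e₁.terminus = e₂.terminus)
      (hw : ¬ e₁.weight ≡ e₂.weight [ZMOD Γ.modulus]) :
      FoldStep Γ { Γ with
        edges := e₁ ::ₘ rest
        modulus := Int.gcd Γ.modulus (e₂.weight - e₁.weight) }
  | shift_fst (e₁ e₂ : WEdge V X) (rest : Multiset (WEdge V X))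
      (hΓ : Γ.edges = e₁ ::ₘ e₂ ::ₘ rest)
      (ho : e₁.origin = e₂.origin) (hl : e₁.label = e₂.label)
      (ht : e₁.terminus ≠ e₂.terminus) :
      FoldStep Γ
        ((({ Γ with edges := e₁ ::ₘ rest } : WDigraph V X).shift e₁.terminus
          (e₁.weight - e₂.weight)).identify e₁.terminus e₂.terminus)
  | shift_snd (e₁ e₂ : WEdge V X) (rest : Multiset (WEdge V X))
      (hΓ : Γ.edges = e₁ ::ₘ e₂ ::ₘ rest)
      (ho : e₁.origin = e₂.origin) (hl : e₁.label = e₂.label)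
      (ht : e₁.terminus ≠ e₂.terminus) :
      FoldStep Γ
        ((({ Γ with edges := e₁ ::ₘ rest } : WDigraph V X).shift e₂.terminus
          (e₂.weight - e₁.weight)).identify e₂.terminus e₁.terminus)

/-- `Γ'` is a result of folding `Γ`: it is folded and is obtained from `Γ` by a finite
sequence of folds. -/
def IsFoldOf (Γ' Γ : WDigraph V X) : Prop :=
  Relation.ReflTransGen FoldStep Γ Γ' ∧ Γ'.IsFolded

end WDigraph

/-! ### Computations that count additions -/

/-- A value together with the number of additions and subtractions spent on computing it. -/
structure Counted (α : Type*) where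
  val : α
  adds : ℕ

namespace Counted

/-- A value obtained without additions. -/
def pure {α : Type*} (a : α) : Counted α := ⟨a, 0⟩

/-- Sequential composition. -/
def bind {α β : Type*} (x : Counted α) (f : α → Counted β) : Counted β :=
  ⟨(f x.val).val, x.adds + (f x.val).adds⟩

/-- One addition. -/
def add {α : Type*} [Add α] (a b : α) : Counted α := ⟨a + b, 1⟩

/-- One subtraction; it is counted as an addition. -/
def sub {α : Type*} [Sub α] (a b : α) : Counted α := ⟨a - b, 1⟩

end Counted

/-! ### Union-find trees with shift values -/

/-- The tree representation of vertex classes: each vertex `v` has a parent `p(v)` (itself for a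
root), a shift value `δ(v)` (irrelevant for a root) and a rank, used for linking. -/
structure ShiftForest (V : Type*) where
  parent : V → V
  shift : V → ℤ
  rank : V → ℕ

namespace ShiftForest

variable {V X : Type*}

/-- All vertices are roots. -/
def discrete (V : Type*) : ShiftForest V := ⟨id, fun _ => 0, fun _ => 0⟩

variable [DecidableEq V]

/-- Find with path compression: returns the updated forest, the root of the tree of `v` and the
total shift `Δ(v)`, where `Δ(v) = 0` for a root and `Δ(v) = δ(v) + Δ(p(v))` otherwise. Every
vertex on the path becomes a child of the root, and its shift value becomes its total shift.
The first argument bounds the recursion depth. -/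
def find : ℕ → ShiftForest V → V → Counted (ShiftForest V × V × ℤ)
  | 0, F, v => .pure (F, v, 0)
  | n + 1, F, v =>
    if F.parent v = v then .pure (F, v, 0)
    else
      (find n F (F.parent v)).bind fun (F', r, d) =>
      (Counted.add (F.shift v) d).bind fun d' =>
      .pure ({ F' with
        parent := Function.update F'.parent v r
        shift := Function.update F'.shift v d' }, r, d')

/-- The edge of the current graph that is represented by the stored edge `e`: its endpoints are
the roots of the classes of the endpoints of `e`, and its weight is the stored weight, plus the
total shift of the origin, minus the total shift of the terminus. -/
def resolve (n : ℕ) (F : ShiftForest V) (e : WEdge V X) :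
    Counted (ShiftForest V × WEdge V X) :=
  (F.find n e.origin).bind fun (F₁, u, du) =>
  (F₁.find n e.terminus).bind fun (F₂, v, dv) =>
  (Counted.add e.weight du).bind fun w =>
  (Counted.sub w dv).bind fun w' =>
  .pure (F₂, { e with origin := u, terminus := v, weight := w' })

/-- Resolve the edges of a list one after another. -/
def resolveList (n : ℕ) : ShiftForest V → List (WEdge V X) →
    Counted (ShiftForest V × List (WEdge V X))
  | F, [] => .pure (F, [])
  | F, e :: es =>
    (F.resolve n e).bind fun (F₁, e') =>
    (resolveList n F₁ es).bind fun (F₂, es') =>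
    .pure (F₂, e' :: es')

/-- Given distinct roots `v₁`, `v₂`, and the weights `a`, `b` of edges `u --> v₁`, `u --> v₂`, make
the root of smaller rank a child of the other one, with the shift value (`a - b` for `v₁`,
`b - a` for `v₂`) that makes the two weights equal. -/
def link (F : ShiftForest V) (v₁ v₂ : V) (a b : ℤ) : Counted (ShiftForest V) :=
  if F.rank v₁ < F.rank v₂ then
    (Counted.sub a b).bind fun c =>
    .pure { F with
      parent := Function.update F.parent v₁ v₂
      shift := Function.update F.shift v₁ c }
  else
    (Counted.sub b a).bind fun c =>
    (if F.rank v₁ = F.rank v₂ then Counted.add (F.rank v₁) 1 else .pure (F.rank v₁)).bind fun k =>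
    .pure
      { parent := Function.update F.parent v₂ v₁
        shift := Function.update F.shift v₂ c
        rank := Function.update F.rank v₁ k }

end ShiftForest

/-! ### The folding procedure -/

/-- A state of the folding procedure: the forest, the stored edges that have not been removed
(with their original endpoints and weights) and the current modulus. -/
structure FoldState (V : Type*) (X : Type*) where
  forest : ShiftForest V
  edges : Multiset (WEdge V X)
  modulus : ℕ

namespace FoldState

variable {V X : Type*} [DecidableEq V]

/-- Two edges of the list of stored edges represent distinct edges of the current graph with the
same origin and the same label. Whether this is so is decided by following parent pointers
(at most `n` times), hence without additions. -/
def Foldable (n : ℕ) (s : FoldState V X) (e₁ e₂ : WEdge V X) (rest : Multiset (WEdge V X)) :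
    Prop :=
  s.edges = e₁ ::ₘ e₂ ::ₘ rest ∧ e₁.label = e₂.label ∧
    s.forest.parent^[n] e₁.origin = s.forest.parent^[n] e₂.origin

/-- Fold `e₁` with `e₂`: resolve both edges, then update the modulus if their termini coincide,
or link the classes of their termini otherwise, and remove `e₂`. (If the two weights are
congruent modulo `N`, then the `gcd` below is equal to `N`.) -/
def foldPair (n : ℕ) (s : FoldState V X) (e₁ e₂ : WEdge V X) (rest : Multiset (WEdge V X)) :
    Counted (FoldState V X) :=
  (s.forest.resolve n e₁).bind fun (F₁, f₁) =>
  (F₁.resolve n e₂).bind fun (F₂, f₂) =>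
  if f₁.terminus = f₂.terminus then
    (Counted.sub f₂.weight f₁.weight).bind fun d =>
    .pure { forest := F₂, edges := e₁ ::ₘ rest, modulus := Int.gcd s.modulus d }
  else
    (F₂.link f₁.terminus f₂.terminus f₁.weight f₂.weight).bind fun F₃ =>
    .pure { forest := F₃, edges := e₁ ::ₘ rest, modulus := s.modulus }

/-- `Reaches Γ s k`: starting from the discrete forest on the vertices of `Γ`, the procedure can
reach the state `s` by a sequence of folds, in any order, performing `k` additions. -/
inductive Reaches (Γ : WDigraph V X) : FoldState V X → ℕ → Prop
  | init : Reaches Γ ⟨ShiftForest.discrete V, Γ.edges, Γ.modulus⟩ 0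
  | fold (s : FoldState V X) (k : ℕ) (e₁ e₂ : WEdge V X) (rest : Multiset (WEdge V X))
      (hs : Reaches Γ s k) (h : s.Foldable Γ.verts.card e₁ e₂ rest) :
      Reaches Γ (s.foldPair Γ.verts.card e₁ e₂ rest).val
        (k + (s.foldPair Γ.verts.card e₁ e₂ rest).adds)

/-- A complete execution of the folding procedure on `Γ`, with output `Γ'` and with `k` additions
in total: folds are performed until no two edges can be folded; then the remaining edges, in
some order, are resolved and returned, together with the roots and the modulus. -/
def Folds (Γ Γ' : WDigraph V X) (k : ℕ) : Prop :=
  ∃ (s : FoldState V X) (k₀ : ℕ) (l : List (WEdge V X)),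
    Reaches Γ s k₀ ∧
    (∀ e₁ e₂ rest, ¬ s.Foldable Γ.verts.card e₁ e₂ rest) ∧
    (l : Multiset (WEdge V X)) = s.edges ∧
    Γ' =
      { verts := Γ.verts.filter fun v => s.forest.parent v = v
        edges := ((s.forest.resolveList Γ.verts.card l).val.2 : Multiset (WEdge V X))
        modulus := s.modulus } ∧
    k = k₀ + (s.forest.resolveList Γ.verts.card l).adds

end FoldState

/-! ### The inverse Ackermann function -/

/-- The inverse Ackermann function: the least `k ≥ 1` with `n ≤ A(k, k)`. -/
noncomputable def invAckermann (n : ℕ) : ℕ := sInf {k | 1 ≤ k ∧ n ≤ ack k k}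

/-! ### Potential of a vertex -/

/-! Correctness and cost are tracked together. A forest is described by the root function `R` and
the total shift `D`. Path compression leaves both unchanged, and linking two roots changes the
represented graph exactly as a shift followed by an identification does (`represented_join`). Hence
each fold of stored edges is one `FoldStep` of the represented graph.

The cost is amortized. A vertex of rank `r` with parent of rank `s` carries `rankPotential L r s`,
the number of Ackermann thresholds above `s`; this is `L * (r + 2)` for a root. Raising the rank of
the parent only lowers it. On a find path, each compressed vertex either loses a threshold, which
pays for its addition, or forces the rest of the path to a lower Ackermann level, so a find costs at
most `L` beyond the potential it releases (`find_spec`). Linking raises the potential by at most `L`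
(`potential_attach_le`).

Thus a fold costs at most `5 * L + 6` and removes an edge, an edge resolved at the end costs at most
`2 * L + 2`, and the initial potential is `2 * L * |V|`. All this needs ranks below `ack L 0`; since
ranks are at most `|V|`, `L = invAckermann |V| + 3` suffices. -/

theorem le_ack_right (m n : ℕ) : n ≤ ack m n := (lt_ack_right m n).le

theorem le_iterate_ack (k i r : ℕ) : r ≤ (ack k)^[i] r :=
  Function.id_le_iterate_of_id_le (fun n => le_ack_right k n) i r

theorem lt_iterate_succ_ack (k i r : ℕ) : r < (ack k)^[i + 1] r := by
  rw [Function.iterate_succ_apply']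
  exact (le_iterate_ack k i r).trans_lt (lt_ack_right _ _)

theorem ack_succ_eq_iterate (k r : ℕ) : ack (k + 1) r = (ack k)^[r + 1] 1 := by
  induction r with
  | zero => simp
  | succ r ih => rw [ack_succ_succ, ih, ← Function.iterate_succ_apply' (ack k)]

/-- This is why `r + 2` thresholds per level are enough: they reach up to level `k + 1`. -/
theorem ack_succ_le_iterate (k r : ℕ) : ack (k + 1) r ≤ (ack k)^[r + 2] r := by
  rw [ack_succ_eq_iterate, Function.iterate_succ_apply _ (r + 1) r]
  exact (ack_mono_right k).iterate (r + 1) (Nat.succ_le_of_lt (ack_pos k r))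

/-- The potential of a vertex of rank `r` whose parent has rank `s`: the number of thresholds
`A(k, ·)^(i+1)(r)` with `k < L` and `i < r + 2` that exceed `s`. -/
def rankPotential (L r s : ℕ) : ℕ :=
  ((Finset.range L ×ˢ Finset.range (r + 2)).filter fun p => s < (ack p.1)^[p.2 + 1] r).card

theorem rankPotential_anti (L r : ℕ) {s s' : ℕ} (h : s ≤ s') :
    rankPotential L r s' ≤ rankPotential L r s :=
  Finset.card_le_card (Finset.monotone_filter_right _ fun _ _ hp => h.trans_lt hp)

theorem rankPotential_self (L r : ℕ) : rankPotential L r r = L * (r + 2) := by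
  rw [rankPotential, Finset.filter_true_of_mem fun p _ => lt_iterate_succ_ack _ _ _]
  simp

/-- Take the first iterate of `ack k` at `r` that exceeds `s`. The iterate before it is at most `s`,
so one more application of `ack k` stays below `s'`, and this threshold is no longer counted. -/
theorem rankPotential_lt {L r s s' k : ℕ} (hk : k < L) (hr : r ≤ s) (hs : s < ack (k + 1) r)
    (hs' : ack k s ≤ s') : rankPotential L r s' < rankPotential L r s := by
  classical
  have hex : ∃ i, s < (ack k)^[i] r := ⟨r + 2, hs.trans_le (ack_succ_le_iterate k r)⟩
  obtain ⟨i, hi⟩ : ∃ i, Nat.find hex = i + 1 := by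
    refine Nat.exists_eq_succ_of_ne_zero fun h0 => ?_
    have := Nat.find_spec hex
    rw [h0] at this
    exact absurd hr (not_le.2 this)
  have hlt : s < (ack k)^[i + 1] r := hi ▸ Nat.find_spec hex
  have hle : (ack k)^[i] r ≤ s := not_lt.1 (Nat.find_min hex (by omega))
  have hir : i + 1 ≤ r + 2 := hi ▸ Nat.find_min' hex (hs.trans_le (ack_succ_le_iterate k r))
  have hle' : (ack k)^[i + 1] r ≤ s' := by
    rw [Function.iterate_succ_apply']
    exact (ack_mono_right k hle).trans hs'
  refine Finset.card_lt_card (Finset.ssubset_iff_of_subset ?_ |>.2 ⟨(k, i), ?_, ?_⟩)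
  · exact Finset.monotone_filter_right _ fun _ _ hp => ((le_ack_right k s).trans hs').trans_lt hp
  · simp only [Finset.mem_filter, Finset.mem_product, Finset.mem_range]
    exact ⟨⟨hk, by omega⟩, hlt⟩
  · simp only [Finset.mem_filter, not_and, not_lt]
    exact fun _ => hle'

/-! ### Forests representing a classification of the vertices -/

namespace ShiftForest

variable {V X : Type*}

/-- In the forest `F`, whose non-root vertices belong to `S`, the vertex `v` has root `R v` and
total shift `D v`, and ranks increase strictly along the path to the root. -/
structure Represents (S : Finset V) (F : ShiftForest V) (R : V → V) (D : V → ℤ) : Prop where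
  root_of_parent : ∀ v, F.parent v = v → R v = v
  shift_of_parent : ∀ v, F.parent v = v → D v = 0
  root_parent : ∀ v, R (F.parent v) = R v
  shift_parent : ∀ v, F.parent v ≠ v → D v = F.shift v + D (F.parent v)
  parent_root : ∀ v, F.parent (R v) = R v
  rank_lt : ∀ v, F.parent v ≠ v → F.rank v < F.rank (F.parent v)
  rank_le : ∀ v, F.rank v ≤ F.rank (R v)
  mem : ∀ v, F.parent v ≠ v → v ∈ S
  root_mem : ∀ v ∈ S, R v ∈ S

namespace Represents

variable {S : Finset V} {F : ShiftForest V} {R : V → V} {D : V → ℤ}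

theorem discrete (S : Finset V) :
    Represents S (discrete V) (fun v => v) (fun _ => 0) := by
  constructor <;> simp [ShiftForest.discrete]

theorem parent_eq_iff (h : Represents S F R D) (v : V) : F.parent v = v ↔ R v = v :=
  ⟨h.root_of_parent v, fun hv => by simpa [hv] using h.parent_root v⟩

theorem root_root (h : Represents S F R D) (v : V) : R (R v) = R v :=
  h.root_of_parent _ (h.parent_root v)

/-- Each step to a proper parent raises the rank, so the rank gap to the root bounds the depth. -/
theorem iterate_parent (h : Represents S F R D) (n : ℕ) (v : V)
    (hn : F.rank (R v) ≤ F.rank v + n) : F.parent^[n] v = R v := by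
  induction n generalizing v with
  | zero =>
    by_contra hv
    have hp : F.parent v ≠ v := fun hp => hv (h.root_of_parent v hp).symm
    have h1 := h.rank_lt v hp
    have h2 := h.rank_le (F.parent v)
    rw [h.root_parent] at h2
    omega
  | succ n ih =>
    rw [Function.iterate_succ_apply, ih, h.root_parent]
    rw [h.root_parent]
    by_cases hp : F.parent v = v
    · rw [hp, h.root_of_parent v hp]; omega
    · have := h.rank_lt v hp
      omega

variable [DecidableEq V]

/-- Making `v` a child of its root preserves the classes and the total shifts. -/
theorem compress (h : Represents S F R D) {v : V} (hv : F.parent v ≠ v) :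
    Represents S { F with
      parent := Function.update F.parent v (R v)
      shift := Function.update F.shift v (D v) } R D := by
  have hRv : R v ≠ v := fun hR => hv ((h.parent_eq_iff v).2 hR)
  have key : ∀ x, Function.update F.parent v (R v) x = x ↔ F.parent x = x := by
    intro x
    rcases eq_or_ne x v with rfl | hx
    · simp [hRv, hv]
    · simp [hx]
  constructor
  · intro x hx
    exact h.root_of_parent x ((key x).1 hx)
  · intro x hx
    exact h.shift_of_parent x ((key x).1 hx)
  · intro x
    rcases eq_or_ne x v with rfl | hx
    · simp [h.root_root]
    · simp [hx, h.root_parent]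
  · intro x hx
    have hx' := (key x).not.1 hx
    rcases eq_or_ne x v with rfl | hxv
    · simp [h.shift_of_parent _ (h.parent_root x)]
    · simpa [hxv] using h.shift_parent x hx'
  · intro x
    exact (key _).2 (h.parent_root x)
  · intro x hx
    have hx' := (key x).not.1 hx
    rcases eq_or_ne x v with rfl | hxv
    · have h1 := h.rank_lt x hv
      have h2 := h.rank_le (F.parent x)
      rw [h.root_parent] at h2
      simpa using h1.trans_le h2
    · simpa [hxv] using h.rank_lt x hx'
  · exact h.rank_le
  · intro x hx
    exact h.mem x ((key x).not.1 hx)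
  · exact h.root_mem

end Represents

/-! ### Amortized cost of finding roots with path compression -/

/-- The sum of the potentials of the vertices in `S`. -/
def potential (L : ℕ) (S : Finset V) (F : ShiftForest V) : ℕ :=
  ∑ v ∈ S, rankPotential L (F.rank v) (F.rank (F.parent v))

theorem potential_discrete (L : ℕ) (S : Finset V) :
    potential L S (discrete V) = 2 * L * S.card := by
  simp [potential, discrete, rankPotential_self, mul_comm]

/-- Changing the parent of `v`, without changing ranks, changes the potential of `v` only. -/
theorem potential_update [DecidableEq V] (L : ℕ) {S : Finset V} (F : ShiftForest V) (δ : V → ℤ)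
    {v : V} (hv : v ∈ S) (r : V) :
    potential L S { F with parent := Function.update F.parent v r, shift := δ } +
        rankPotential L (F.rank v) (F.rank (F.parent v)) =
      potential L S F + rankPotential L (F.rank v) (F.rank r) := by
  simp only [potential]
  rw [← Finset.add_sum_erase S _ hv, ← Finset.add_sum_erase S _ hv]
  have : ∀ x ∈ S.erase v,
      rankPotential L (F.rank x) (F.rank (Function.update F.parent v r x)) =
        rankPotential L (F.rank x) (F.rank (F.parent x)) := by
    intro x hx
    rw [Function.update_of_ne (Finset.ne_of_mem_erase hx)]
  rw [Finset.sum_congr rfl this, Function.update_self]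
  omega

/-- Uniform bounds on the ranks, which make recursion depth `n` sufficient and bound the
amortized cost of `find` by `L`. -/
def RankBounded (L n : ℕ) (F : ShiftForest V) : Prop :=
  ∀ v, F.rank v ≤ n ∧ F.rank v < ack L 0

theorem RankBounded.of_rank_eq {L n : ℕ} {F F' : ShiftForest V} (hb : F.RankBounded L n)
    (h : F'.rank = F.rank) : F'.RankBounded L n := by
  intro v
  rw [h]
  exact hb v

variable [DecidableEq V]

/-- Correctness and amortized cost of `find`. -/
theorem find_spec {S : Finset V} {R : V → V} {D : V → ℤ} {F : ShiftForest V}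
    (h : Represents S F R D) (L n : ℕ) (v : V) (hn : F.rank (R v) ≤ F.rank v + n) :
    (F.find n v).val.2 = (R v, D v) ∧ Represents S (F.find n v).val.1 R D ∧
      (F.find n v).val.1.rank = F.rank ∧
      (∀ x, F.rank x < F.rank v → (F.find n v).val.1.parent x = F.parent x) ∧
      ∀ t ≤ L, F.rank (R v) < ack t (F.rank v) →
        potential L S (F.find n v).val.1 + (F.find n v).adds ≤ potential L S F + t := by
  induction n generalizing v with
  | zero =>
    have hv : R v = v := by simpa using (h.iterate_parent 0 v hn).symm
    have hp := (h.parent_eq_iff v).2 hv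
    simp [find, Counted.pure, hv, h.shift_of_parent v hp, h]
  | succ n ih =>
    by_cases hp : F.parent v = v
    · simp [find, hp, Counted.pure, h.root_of_parent v hp, h.shift_of_parent v hp, h]
    have hlt := h.rank_lt v hp
    have hRp := h.root_parent v
    obtain ⟨h2, hrep, hrank, hpar, hcost⟩ := ih (F.parent v) (by rw [hRp]; omega)
    rw [hRp] at h2 hcost
    -- The recursive call starts at a vertex of larger rank, so it has not moved `v`; only `v`
    -- itself remains to be accounted for.
    have hpv := hpar v hlt
    have hle := h.rank_le (F.parent v)
    rw [hRp] at hle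
    generalize hc : F.find n (F.parent v) = c at h2 hrep hrank hpar hcost hpv
    obtain ⟨⟨F', r, d⟩, m⟩ := c
    simp only [Prod.mk.injEq] at h2 hrep hrank hpar hcost hpv
    obtain ⟨rfl, rfl⟩ := h2
    have hfind : F.find (n + 1) v =
        ⟨({ F' with
            parent := Function.update F'.parent v (R v)
            shift := Function.update F'.shift v (D v) }, R v, D v), m + 1⟩ := by
      simp [find, hp, Counted.bind, Counted.pure, Counted.add, hc, ← h.shift_parent v hp]
    rw [hfind]
    refine ⟨rfl, hrep.compress (by rwa [hpv]), hrank, ?_, ?_⟩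
    · intro x hx
      have hxv : x ≠ v := by rintro rfl; exact lt_irrefl _ hx
      simpa [hxv] using hpar x (hx.trans hlt)
    · intro t ht hRt
      have hupd := potential_update L F' (Function.update F'.shift v (D v)) (h.mem v hp) (R v)
      rw [hpv] at hupd
      -- The least such level is positive, because level `0` is the successor function and the
      -- parent has larger rank.
      have hex : ∃ j, F.rank (F.parent v) < ack j (F.rank v) := ⟨t, hle.trans_lt hRt⟩
      obtain ⟨k, hk⟩ : ∃ k, Nat.find hex = k + 1 := by
        refine Nat.exists_eq_succ_of_ne_zero fun h0 => ?_
        have := Nat.find_spec hex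
        rw [h0, ack_zero] at this
        omega
      have hkt : k + 1 ≤ t := hk ▸ Nat.find_min' hex (hle.trans_lt hRt)
      have hks : F.rank (F.parent v) < ack (k + 1) (F.rank v) := hk ▸ Nat.find_spec hex
      simp only [hrank] at hupd ⊢
      -- Here the rest of the path costs at most `k`, and the addition at `v` fits in `k + 1 ≤ t`.
      by_cases hkR : F.rank (R v) < ack k (F.rank (F.parent v))
      · have h1 := hcost k (by omega) hkR
        have h2 := rankPotential_anti L (F.rank v) hle
        omega
      -- Here the new parent rank is at least `ack k` of the old one, so `v` loses potential and
      -- pays for its own addition.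
      · have h1 := hcost t ht (hRt.trans_le (ack_mono_right t hlt.le))
        have h2 := rankPotential_lt (L := L) (by omega) hlt.le hks (not_lt.1 hkR)
        omega

/-- The edge represented by `e`, if `v` has root `R v` and total shift `D v`. -/
def edgeRep (R : V → V) (D : V → ℤ) (e : WEdge V X) : WEdge V X :=
  { e with
    origin := R e.origin
    terminus := R e.terminus
    weight := e.weight + D e.origin - D e.terminus }

/-- Two finds at amortized cost `L` each, plus an addition and a subtraction for the weight. -/
theorem resolve_spec {S : Finset V} {R : V → V} {D : V → ℤ} {F : ShiftForest V} {L n : ℕ}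
    (h : Represents S F R D) (hb : F.RankBounded L n) (e : WEdge V X) :
    (F.resolve n e).val.2 = edgeRep R D e ∧ Represents S (F.resolve n e).val.1 R D ∧
      (F.resolve n e).val.1.rank = F.rank ∧
      potential L S (F.resolve n e).val.1 + (F.resolve n e).adds ≤
        potential L S F + (2 * L + 2) := by
  have hb' : ∀ v w, F.rank v < ack L (F.rank w) := fun v w =>
    (hb v).2.trans_le (ack_mono_right L (Nat.zero_le _))
  obtain ⟨h2, hrep, hrank, -, hcost⟩ := find_spec h L n e.origin
    ((hb _).1.trans (Nat.le_add_left _ _))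
  have hcost := hcost L le_rfl (hb' _ _)
  generalize hc : F.find n e.origin = c at h2 hrep hrank hcost
  obtain ⟨⟨F₁, r, d⟩, m⟩ := c
  simp only [Prod.mk.injEq] at h2 hrep hrank hcost
  obtain ⟨rfl, rfl⟩ := h2
  obtain ⟨h2', hrep', hrank', -, hcost'⟩ := find_spec hrep L n e.terminus
    (by rw [hrank]; exact (hb _).1.trans (Nat.le_add_left _ _))
  have hcost' := hcost' L le_rfl (by rw [hrank]; exact hb' _ _)
  generalize hc' : F₁.find n e.terminus = c at h2' hrep' hrank' hcost'
  obtain ⟨⟨F₂, r, d⟩, m'⟩ := c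
  simp only [Prod.mk.injEq] at h2' hrep' hrank' hcost'
  obtain ⟨rfl, rfl⟩ := h2'
  simp only [resolve, Counted.bind, Counted.pure, Counted.add, Counted.sub, hc, hc', edgeRep]
  exact ⟨trivial, hrep', hrank'.trans hrank, by omega⟩

theorem resolveList_spec {S : Finset V} {R : V → V} {D : V → ℤ} {F : ShiftForest V} {L n : ℕ}
    (h : Represents S F R D) (hb : F.RankBounded L n) (l : List (WEdge V X)) :
    (F.resolveList n l).val.2 = l.map (edgeRep R D) ∧
      (F.resolveList n l).adds ≤ potential L S F + (2 * L + 2) * l.length := by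
  induction l generalizing F with
  | nil => simp [resolveList, Counted.pure]
  | cons e l ih =>
    obtain ⟨h2, hrep, hrank, hcost⟩ := resolve_spec h hb e
    obtain ⟨h3, hcost'⟩ := ih hrep (hb.of_rank_eq hrank)
    generalize hc : F.resolve n e = c at *
    obtain ⟨⟨F₁, f⟩, m⟩ := c
    simp only at h2 h3 hcost hcost'
    simp only [resolveList, Counted.bind, Counted.pure, hc, h2, h3, List.map_cons,
      List.length_cons, mul_add _ l.length]
    exact ⟨trivial, by omega⟩

/-! ### Linking two trees -/

/-- The root function after the class of `v` has been joined to that of the root `w`. -/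
def joinRoot (R : V → V) (v w : V) (x : V) : V := if R x = v then w else R x

theorem filter_joinRoot (S : Finset V) {R : V → V} {v w : V} (hvw : v ≠ w) (hv : R v = v)
    (hw : R w = w) :
    (S.filter fun x => joinRoot R v w x = x) = (S.filter fun x => R x = x).erase v := by
  ext x
  rw [Finset.mem_erase, Finset.mem_filter, Finset.mem_filter, joinRoot]
  by_cases hx : R x = v
  · rw [if_pos hx]
    constructor
    · rintro ⟨-, rfl⟩
      exact absurd (hw.symm.trans hx).symm hvw
    · rintro ⟨h1, -, h2⟩
      exact absurd (h2.symm.trans hx) h1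
  · rw [if_neg hx]
    constructor
    · rintro ⟨h1, h2⟩
      exact ⟨fun h3 => hx (by rw [h3, hv]), h1, h2⟩
    · exact fun h => h.2

/-- The total shifts after the root `v` has become a child, with shift value `c`. -/
def joinShift (R : V → V) (D : V → ℤ) (v : V) (c : ℤ) (x : V) : ℤ :=
  if R x = v then D x + c else D x

/-- The forest in which the root `v` has become a child of `w`, which receives rank `k`. -/
def attach (F : ShiftForest V) (v w : V) (c : ℤ) (k : ℕ) : ShiftForest V where
  parent := Function.update F.parent v w
  shift := Function.update F.shift v c
  rank := Function.update F.rank w k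

/-- Every path in the old tree of `v` now ends with the extra summand `c`, so its total shifts all
change by `c`. -/
theorem Represents.attach {S : Finset V} {R : V → V} {D : V → ℤ} {F : ShiftForest V}
    (h : Represents S F R D) {v w : V} (hvw : v ≠ w) (hv : R v = v) (hw : R w = w)
    (hvS : v ∈ S) (hwS : w ∈ S) (c : ℤ) {k : ℕ} (hk : F.rank w ≤ k) (hvk : F.rank v < k) :
    Represents S (F.attach v w c k) (joinRoot R v w) (joinShift R D v c) := by
  have hpv := (h.parent_eq_iff v).2 hv
  have hpw := (h.parent_eq_iff w).2 hw
  have hrank : ∀ x, F.rank x ≤ (F.attach v w c k).rank x := by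
    intro x
    rcases eq_or_ne x w with rfl | hx
    · simpa [ShiftForest.attach] using hk
    · simp [ShiftForest.attach, hx]
  have hne : ∀ x, (F.attach v w c k).parent x = x → x ≠ v ∧ F.parent x = x := by
    intro x hx
    rcases eq_or_ne x v with rfl | hxv
    · simp [ShiftForest.attach, hvw.symm] at hx
    · exact ⟨hxv, by simpa [ShiftForest.attach, hxv] using hx⟩
  constructor
  · intro x hx
    obtain ⟨hxv, hx⟩ := hne x hx
    simp [joinRoot, h.root_of_parent x hx, hxv]
  · intro x hx
    obtain ⟨hxv, hx⟩ := hne x hx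
    simp [joinShift, h.root_of_parent x hx, hxv, h.shift_of_parent x hx]
  · intro x
    rcases eq_or_ne x v with rfl | hxv
    · simp [ShiftForest.attach, joinRoot, hv, hw]
    · simp [ShiftForest.attach, joinRoot, hxv, h.root_parent]
  · intro x hx
    rcases eq_or_ne x v with rfl | hxv
    · simp [ShiftForest.attach, joinShift, hv, hw, hvw.symm, h.shift_of_parent _ hpv,
        h.shift_of_parent _ hpw]
    · have hx' : F.parent x ≠ x := by simpa [ShiftForest.attach, hxv] using hx
      simp only [ShiftForest.attach, joinShift, ne_eq, hxv, not_false_eq_true,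
        Function.update_of_ne, h.root_parent, h.shift_parent x hx']
      split_ifs <;> ring
  · intro x
    by_cases hx : R x = v
    · simp [ShiftForest.attach, joinRoot, hx, hvw.symm, hpw]
    · simp [ShiftForest.attach, joinRoot, hx, h.parent_root]
  · intro x hx
    rcases eq_or_ne x v with rfl | hxv
    · simpa [ShiftForest.attach, hvw] using hvk
    · have hx' : F.parent x ≠ x := by simpa [ShiftForest.attach, hxv] using hx
      have hxw : x ≠ w := by rintro rfl; exact hx' hpw
      have h1 : (F.attach v w c k).rank x = F.rank x := by simp [ShiftForest.attach, hxw]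
      have h2 : (F.attach v w c k).parent x = F.parent x := by simp [ShiftForest.attach, hxv]
      rw [h1, h2]
      exact (h.rank_lt x hx').trans_le (hrank _)
  · intro x
    by_cases hxw : x = w
    · simp [joinRoot, hxw, hw, hvw.symm]
    have h1 : (F.attach v w c k).rank x = F.rank x := by simp [ShiftForest.attach, hxw]
    rw [h1]
    by_cases hx : R x = v
    · have := h.rank_le x
      rw [hx] at this
      simpa [ShiftForest.attach, joinRoot, hx] using this.trans hvk.le
    · simpa [joinRoot, hx] using (h.rank_le x).trans (hrank _)
  · intro x hx
    rcases eq_or_ne x v with rfl | hxv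
    · exact hvS
    · exact h.mem x (by simpa [ShiftForest.attach, hxv] using hx)
  · intro x hx
    unfold joinRoot
    split_ifs
    · exact hwS
    · exact h.root_mem x hx

/-- Only `w` can gain: it stays a root, and its rank grows by at most one. For all other vertices
the rank of the parent does not decrease. -/
theorem potential_attach_le {S : Finset V} {F : ShiftForest V} (L : ℕ) {v w : V} (hvw : v ≠ w)
    (hv : F.parent v = v) (hw : F.parent w = w) (c : ℤ) {k : ℕ} (hk : F.rank w ≤ k)
    (hk' : k ≤ F.rank w + 1) (hvk : F.rank v < k) :
    potential L S (F.attach v w c k) ≤ potential L S F + L := by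
  have hle : ∀ x ∈ S, rankPotential L ((F.attach v w c k).rank x)
      ((F.attach v w c k).rank ((F.attach v w c k).parent x)) ≤
      rankPotential L (F.rank x) (F.rank (F.parent x)) + if x = w then L else 0 := by
    intro x _
    rcases eq_or_ne x w with rfl | hxw
    · simp only [attach, Function.update_self, ne_eq, hvw.symm, not_false_eq_true,
        Function.update_of_ne, hw, if_true, rankPotential_self]
      calc L * (k + 2) ≤ L * (F.rank x + 1 + 2) := by gcongr
        _ = _ := by ring
    · rw [if_neg hxw, add_zero]
      simp only [attach, ne_eq, hxw, not_false_eq_true, Function.update_of_ne]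
      apply rankPotential_anti
      rcases eq_or_ne x v with rfl | hxv
      · simpa [hv] using hvk.le
      · rw [Function.update_of_ne hxv]
        rcases eq_or_ne (F.parent x) w with hp | hp
        · simpa [hp] using hk
        · simp [hp]
  refine (Finset.sum_le_sum hle).trans ?_
  rw [Finset.sum_add_distrib, Finset.sum_ite_eq']
  simp only [potential]
  split_ifs <;> omega

theorem link_eq_attach (F : ShiftForest V) (v w : V) (a b : ℤ) :
    (F.link v w a b).adds ≤ 2 ∧
    ((F.rank v < F.rank w ∧ (F.link v w a b).val = F.attach v w (a - b) (F.rank w)) ∨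
      ∃ k, F.rank v ≤ k ∧ k ≤ F.rank v + 1 ∧ F.rank w < k ∧
        (F.link v w a b).val = F.attach w v (b - a) k) := by
  by_cases h : F.rank v < F.rank w
  · simp [link, h, Counted.bind, Counted.pure, Counted.sub, attach]
  by_cases h' : F.rank v = F.rank w
  · refine ⟨by simp [link, h', Counted.bind, Counted.pure, Counted.sub, Counted.add],
      Or.inr ⟨F.rank v + 1, by omega, by omega, by omega, ?_⟩⟩
    simp [link, h', Counted.bind, Counted.pure, Counted.sub, Counted.add, attach]
  · refine ⟨by simp [link, h, h', Counted.bind, Counted.pure, Counted.sub],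
      Or.inr ⟨F.rank v, by omega, by omega, by omega, ?_⟩⟩
    simp [link, h, h', Counted.bind, Counted.pure, Counted.sub, attach]

end ShiftForest

/-! ### The folding procedure -/

namespace WDigraph

open ShiftForest

variable {V X : Type*} [DecidableEq V]

/-- The graph represented by stored edges whose vertices `v` have root `R v` and total shift
`D v`. -/
def represented (S : Finset V) (R : V → V) (D : V → ℤ) (E : Multiset (WEdge V X)) (N : ℕ) :
    WDigraph V X where
  verts := S.filter fun v => R v = v
  edges := E.map (edgeRep R D)
  modulus := N

/-- Joining the classes of two roots is shifting one of them and identifying it with the other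
one. -/
theorem represented_join (S : Finset V) {R : V → V} {D : V → ℤ} {v w : V} (hvw : v ≠ w)
    (hv : R v = v) (hw : R w = w) (c : ℤ)
    (E : Multiset (WEdge V X)) (N : ℕ) :
    represented S (joinRoot R v w) (joinShift R D v c) E N =
      ((represented S R D E N).shift v c).identify v w := by
  ext1
  · exact filter_joinRoot S hvw hv hw
  · simp only [represented, identify, shift, Multiset.map_map, Function.comp_def]
    refine Multiset.map_congr rfl fun e _ => ?_
    -- If both endpoints lie in the class of `v`, the two contributions of `c` cancel; this is why
    -- loops are not shifted.
    by_cases ho : R e.origin = v <;> by_cases ht : R e.terminus = v <;>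
      simp [edgeRep, joinRoot, joinShift, ho, ht] <;> ring
  · rfl

end WDigraph

namespace FoldState

open ShiftForest WDigraph

variable {V X : Type*} [DecidableEq V]

/-- The state `s` represents a graph obtained from `Γ` by folds; its vertices have roots `R v`
and total shifts `D v`. -/
structure Invariant (Γ : WDigraph V X) (s : FoldState V X) (R : V → V) (D : V → ℤ) : Prop where
  rep : Represents Γ.verts s.forest R D
  rank_card : ∀ v, s.forest.rank v + (Γ.verts.filter fun v => R v = v).card ≤ Γ.verts.card
  sub : s.edges ≤ Γ.edges
  folds : Relation.ReflTransGen FoldStep Γ (represented Γ.verts R D s.edges s.modulus)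

theorem Invariant.init (Γ : WDigraph V X) :
    Invariant Γ ⟨ShiftForest.discrete V, Γ.edges, Γ.modulus⟩ (fun v => v) (fun _ => 0) where
  rep := Represents.discrete _
  rank_card := by simp [ShiftForest.discrete]
  sub := le_rfl
  folds := by
    have : represented Γ.verts (fun v => v) (fun _ => 0) Γ.edges Γ.modulus = Γ := by
      have hid : edgeRep (X := X) (fun v : V => v) (fun _ => 0) = id := by
        ext1 e
        simp [edgeRep]
      ext1 <;> simp [represented, hid]
    rw [this]

theorem Invariant.rankBounded {Γ : WDigraph V X} {s : FoldState V X} {R : V → V} {D : V → ℤ}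
    (h : Invariant Γ s R D) {L : ℕ} (hL : Γ.verts.card < ack L 0) :
    s.forest.RankBounded L Γ.verts.card := by
  intro v
  have := h.rank_card v
  omega

theorem Invariant.iterate_parent {Γ : WDigraph V X} {s : FoldState V X} {R : V → V} {D : V → ℤ}
    (h : Invariant Γ s R D) (v : V) : s.forest.parent^[Γ.verts.card] v = R v := by
  have := h.rank_card (R v)
  exact h.rep.iterate_parent _ v (by omega)

theorem card_filter_joinRoot_add_one {S : Finset V} {R : V → V} {v w : V} (hvw : v ≠ w)
    (hv : R v = v) (hw : R w = w) (hvS : v ∈ S) :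
    (S.filter fun x => joinRoot R v w x = x).card + 1 = (S.filter fun x => R x = x).card := by
  rw [filter_joinRoot S hvw hv hw]
  exact Finset.card_erase_add_one (Finset.mem_filter.2 ⟨hvS, hv⟩)

/-- A link destroys one root and raises a rank by at most one. The resulting bound of `|S|` on ranks
is crude compared with the logarithmic one, but it is enough here. -/
theorem rank_card_attach {S : Finset V} {R : V → V} {F : ShiftForest V} {v w : V} (hvw : v ≠ w)
    (hv : R v = v) (hw : R w = w) (hvS : v ∈ S) (c : ℤ) {k : ℕ} (hk : k ≤ F.rank w + 1)
    (h : ∀ x, F.rank x + (S.filter fun x => R x = x).card ≤ S.card) (x : V) :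
    (F.attach v w c k).rank x + (S.filter fun x => joinRoot R v w x = x).card ≤ S.card := by
  have h1 := card_filter_joinRoot_add_one hvw hv hw hvS
  have h2 := h x
  rcases eq_or_ne x w with rfl | hx
  · simp only [attach, Function.update_self]
    omega
  · simp only [attach, ne_eq, hx, not_false_eq_true, Function.update_of_ne]
    omega

/-- Folding two stored edges performs one fold on the represented graph. -/
theorem Invariant.foldPair {Γ : WDigraph V X} (hΓ : Γ.WellFormed) {s : FoldState V X}
    {R : V → V} {D : V → ℤ} (h : Invariant Γ s R D) {L : ℕ} (hL : Γ.verts.card < ack L 0)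
    {e₁ e₂ : WEdge V X} {rest : Multiset (WEdge V X)}
    (hf : s.Foldable Γ.verts.card e₁ e₂ rest) :
    (∃ R' D', Invariant Γ (s.foldPair Γ.verts.card e₁ e₂ rest).val R' D') ∧
      potential L Γ.verts (s.foldPair Γ.verts.card e₁ e₂ rest).val.forest +
          (s.foldPair Γ.verts.card e₁ e₂ rest).adds ≤
        potential L Γ.verts s.forest + (5 * L + 6) := by
  obtain ⟨hE, hlab, horig⟩ := hf
  rw [h.iterate_parent, h.iterate_parent] at horig
  have hb := h.rankBounded hL
  set n := Γ.verts.card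
  obtain ⟨hv₁, hrep₁, hrank₁, hcost₁⟩ := resolve_spec h.rep hb e₁
  generalize hc₁ : s.forest.resolve n e₁ = c₁ at hv₁ hrep₁ hrank₁ hcost₁
  obtain ⟨⟨F₁, f₁⟩, m₁⟩ := c₁
  simp only at hv₁ hrep₁ hrank₁ hcost₁
  obtain ⟨hv₂, hrep₂, hrank₂, hcost₂⟩ := resolve_spec hrep₁ (hb.of_rank_eq hrank₁) e₂
  generalize hc₂ : F₁.resolve n e₂ = c₂ at hv₂ hrep₂ hrank₂ hcost₂
  obtain ⟨⟨F₂, f₂⟩, m₂⟩ := c₂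
  simp only at hv₂ hrep₂ hrank₂ hcost₂
  rw [hrank₁] at hrank₂
  have hgraph : (represented Γ.verts R D s.edges s.modulus).edges =
      edgeRep R D e₁ ::ₘ edgeRep R D e₂ ::ₘ rest.map (edgeRep R D) := by
    simp [represented, hE]
  have hsub : e₁ ::ₘ rest ≤ Γ.edges :=
    (Multiset.cons_le_cons _ (Multiset.le_cons_self _ _)).trans (hE ▸ h.sub)
  have hS₁ : R e₁.terminus ∈ Γ.verts :=
    h.rep.root_mem _ (hΓ e₁ (Multiset.mem_of_le h.sub (by simp [hE]))).2
  have hS₂ : R e₂.terminus ∈ Γ.verts :=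
    h.rep.root_mem _ (hΓ e₂ (Multiset.mem_of_le h.sub (by simp [hE]))).2
  rw [← hv₁, ← hv₂] at hgraph
  have hT₁ : f₁.terminus = R e₁.terminus := by rw [hv₁]; rfl
  have hT₂ : f₂.terminus = R e₂.terminus := by rw [hv₂]; rfl
  replace horig : f₁.origin = f₂.origin := by rw [hv₁, hv₂]; exact horig
  replace hlab : f₁.label = f₂.label := by rw [hv₁, hv₂]; exact hlab
  rw [← hT₁] at hS₁
  rw [← hT₂] at hS₂
  simp only [FoldState.foldPair, Counted.bind, Counted.pure, hc₁, hc₂]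
  by_cases hT : f₁.terminus = f₂.terminus
  · rw [if_pos hT]
    refine ⟨⟨R, D, hrep₂, by simpa only [hrank₂] using h.rank_card, hsub, ?_⟩, ?_⟩
    · refine h.folds.tail ?_
      by_cases hw : f₁.weight ≡ f₂.weight [ZMOD s.modulus]
      -- The uniform gcd update also covers congruent weights, including modulus `0`, where the
      -- difference is `0`.
      · have hg : Int.gcd s.modulus (Counted.sub f₂.weight f₁.weight).val = s.modulus := by
          have := Int.gcd_eq_left (Int.natCast_nonneg _) hw.dvd
          exact_mod_cast this
        convert FoldStep.congr f₁ f₂ _ hgraph horig hlab hT hw using 1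
        simp only [represented, hg, Multiset.map_cons, ← hv₁]
      · convert FoldStep.not_congr f₁ f₂ _ hgraph horig hlab hT hw using 1
        simp [represented, Counted.sub, hv₁]
    · simp only [Counted.sub]
      omega
  · rw [if_neg hT]
    have hR₁ : R f₁.terminus = f₁.terminus := by rw [hT₁, h.rep.root_root]
    have hR₂ : R f₂.terminus = f₂.terminus := by rw [hT₂, h.rep.root_root]
    have hp₁ := (hrep₂.parent_eq_iff _).2 hR₁
    have hp₂ := (hrep₂.parent_eq_iff _).2 hR₂
    have hrc : ∀ v, F₂.rank v + (Γ.verts.filter fun v => R v = v).card ≤ Γ.verts.card := by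
      simpa only [hrank₂] using h.rank_card
    obtain ⟨hadds, ⟨hlt, hval⟩ | ⟨k, hk, hk', hlt, hval⟩⟩ :=
      link_eq_attach F₂ f₁.terminus f₂.terminus f₁.weight f₂.weight
    · have hpot := potential_attach_le (S := Γ.verts) L hT hp₁ hp₂ (f₁.weight - f₂.weight)
        le_rfl (Nat.le_succ _) hlt
      rw [hval]
      refine ⟨⟨_, _, hrep₂.attach hT hR₁ hR₂ hS₁ hS₂ _ le_rfl hlt,
        rank_card_attach hT hR₁ hR₂ hS₁ _ (Nat.le_succ _) hrc, hsub, ?_⟩, ?_⟩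
      · refine h.folds.tail ?_
        rw [represented_join _ hT hR₁ hR₂]
        convert FoldStep.shift_fst f₁ f₂ _ hgraph horig hlab hT using 3
        simp [represented, hv₁]
      · simp only
        omega
    · have hpot := potential_attach_le (S := Γ.verts) L (Ne.symm hT) hp₂ hp₁
        (f₂.weight - f₁.weight) hk hk' hlt
      rw [hval]
      refine ⟨⟨_, _, hrep₂.attach (Ne.symm hT) hR₂ hR₁ hS₂ hS₁ _ hk hlt,
        rank_card_attach (Ne.symm hT) hR₂ hR₁ hS₂ _ hk' hrc, hsub, ?_⟩, ?_⟩
      · refine h.folds.tail ?_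
        rw [represented_join _ (Ne.symm hT) hR₂ hR₁]
        convert FoldStep.shift_snd f₁ f₂ _ hgraph horig hlab hT using 3
        simp [represented, hv₁]
      · simp only
        omega

theorem foldPair_edges (n : ℕ) (s : FoldState V X) (e₁ e₂ : WEdge V X)
    (rest : Multiset (WEdge V X)) : (s.foldPair n e₁ e₂ rest).val.edges = e₁ ::ₘ rest := by
  simp only [foldPair, Counted.bind, Counted.pure]
  split_ifs <;> rfl

/-! ### Total cost and output of an execution -/

/-- Each stored edge holds a budget of `5 * L + 6`, which its removal releases: four finds, four
weight operations, and at most `L + 2` for linking. -/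
theorem Reaches.invariant {Γ : WDigraph V X} (hΓ : Γ.WellFormed) {L : ℕ}
    (hL : Γ.verts.card < ack L 0) {s : FoldState V X} {k : ℕ} (hs : Reaches Γ s k) :
    (∃ R D, Invariant Γ s R D) ∧
      potential L Γ.verts s.forest + k + (5 * L + 6) * s.edges.card ≤
        2 * L * Γ.verts.card + (5 * L + 6) * Γ.edges.card := by
  induction hs with
  | init => exact ⟨⟨_, _, Invariant.init Γ⟩, by simp [potential_discrete]⟩
  | fold s k e₁ e₂ rest _ h ih =>
    obtain ⟨⟨R, D, hinv⟩, hcost⟩ := ih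
    obtain ⟨hinv', hcost'⟩ := hinv.foldPair hΓ hL h
    refine ⟨hinv', ?_⟩
    rw [h.1] at hcost
    rw [foldPair_edges]
    simp only [Multiset.card_cons, mul_add, mul_one] at hcost ⊢
    omega

theorem Reaches.exists_complete {Γ : WDigraph V X} {s : FoldState V X} {k : ℕ}
    (hs : Reaches Γ s k) :
    ∃ s' k', Reaches Γ s' k' ∧ ∀ e₁ e₂ rest, ¬ s'.Foldable Γ.verts.card e₁ e₂ rest := by
  induction hm : s.edges.card generalizing s k with
  | zero =>
    refine ⟨s, k, hs, fun e₁ e₂ rest h => ?_⟩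
    rw [h.1] at hm
    simp at hm
  | succ m ih =>
    by_cases hf : ∃ e₁ e₂ rest, s.Foldable Γ.verts.card e₁ e₂ rest
    · obtain ⟨e₁, e₂, rest, hf⟩ := hf
      refine ih (Reaches.fold s k e₁ e₂ rest hs hf) ?_
      rw [hf.1] at hm
      rw [foldPair_edges]
      simpa using hm
    · push Not at hf
      exact ⟨s, k, hs, hf⟩

theorem exists_folds (Γ : WDigraph V X) : ∃ (Γ' : WDigraph V X) (k : ℕ), Folds Γ Γ' k := by
  obtain ⟨s, k, hs, hf⟩ := (Reaches.init (Γ := Γ)).exists_complete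
  exact ⟨_, _, s, k, s.edges.toList, hs, hf, s.edges.coe_toList, rfl, rfl⟩

/-- Output and cost of a complete execution. -/
theorem Folds.spec {Γ : WDigraph V X} (hΓ : Γ.WellFormed) {L : ℕ} (hL : Γ.verts.card < ack L 0)
    {Γ' : WDigraph V X} {k : ℕ} (h : Folds Γ Γ' k) :
    Γ'.IsFoldOf Γ ∧ k ≤ 2 * L * Γ.verts.card + (5 * L + 6) * Γ.edges.card := by
  obtain ⟨s, k₀, l, hs, hnf, hl, rfl, rfl⟩ := h
  obtain ⟨⟨R, D, hinv⟩, hcost⟩ := hs.invariant hΓ hL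
  obtain ⟨hval, hadds⟩ := resolveList_spec hinv.rep (hinv.rankBounded hL) l
  rw [← hl, Multiset.coe_card] at hcost
  -- The unspent budget of the surviving edges pays for their final resolution.
  have hlen : (2 * L + 2) * l.length ≤ (5 * L + 6) * l.length := by gcongr <;> omega
  refine ⟨⟨?_, ?_⟩, by omega⟩
  · convert hinv.folds using 1
    simp only [represented, hval, ← hl, hinv.rep.parent_eq_iff, Multiset.map_coe]
  · intro f₁ f₂ rest hE ho hlab
    simp only [hval, ← Multiset.map_coe, hl] at hE
    classical
    -- Two output edges violating foldedness lift to stored edges that could still be folded.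
    obtain ⟨e₁, h₁, rfl, hE'⟩ := (Multiset.map_eq_cons ..).2 hE
    obtain ⟨e₂, h₂, rfl, -⟩ := (Multiset.map_eq_cons ..).2 hE'
    refine hnf e₁ e₂ _ ⟨by rw [Multiset.cons_erase h₂, Multiset.cons_erase h₁], hlab, ?_⟩
    rw [hinv.iterate_parent, hinv.iterate_parent]
    exact ho

end FoldState

/-! ### The inverse Ackermann bound -/

theorem exists_le_ack_self (n : ℕ) : ∃ k, 1 ≤ k ∧ n ≤ ack k k :=
  ⟨n + 1, by omega, (Nat.le_succ n).trans (le_ack_right _ _)⟩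

theorem one_le_invAckermann (n : ℕ) : 1 ≤ invAckermann n :=
  (Nat.sInf_mem (exists_le_ack_self n)).1

theorem lt_ack_invAckermann_add_three (n : ℕ) : n < ack (invAckermann n + 3) 0 := by
  have h : n ≤ ack (invAckermann n) (invAckermann n) := (Nat.sInf_mem (exists_le_ack_self n)).2
  refine h.trans_lt ?_
  generalize invAckermann n = a
  -- Three extra levels turn the argument `0` into `ack (a + 1) 1`, which exceeds `a`.
  rw [ack_succ_zero, ack_succ_succ, ack_succ_zero]
  calc ack a a < ack (a + 1) a := ack_strictMono_left a (Nat.lt_succ_self a)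
    _ ≤ ack (a + 1) (ack (a + 1) 1) := ack_mono_right _ (by
      have := add_lt_ack (a + 1) 1
      omega)

theorem mainTheorem6 :
    ∃ K : ℕ, ∀ (V : Type*) (X : Type*) [DecidableEq V] (Γ : WDigraph V X), Γ.WellFormed →
      (∃ (Γ' : WDigraph V X) (k : ℕ), FoldState.Folds Γ Γ' k) ∧
      ∀ (Γ' : WDigraph V X) (k : ℕ), FoldState.Folds Γ Γ' k →
        Γ'.IsFoldOf Γ ∧
        k ≤ K * (Γ.verts.card + Γ.edges.card) * invAckermann Γ.verts.card ∧
        ∀ c : ℕ, Γ.edges.card ≤ c * Γ.verts.card →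
          k ≤ K * (c + 1) * Γ.verts.card * invAckermann Γ.verts.card := by
  -- With `L = a + 3`, the edge coefficient is `5 * a + 21`, at most `26 * a` since `a ≥ 1`.
  refine ⟨26, fun V X _ Γ hΓ => ⟨FoldState.exists_folds Γ, fun Γ' k h => ?_⟩⟩
  obtain ⟨hfold, hk⟩ := h.spec hΓ (lt_ack_invAckermann_add_three _)
  have ha := one_le_invAckermann Γ.verts.card
  have hbound : k ≤ 26 * (Γ.verts.card + Γ.edges.card) * invAckermann Γ.verts.card := by
    generalize invAckermann Γ.verts.card = a at hk ha
    calc k ≤ 2 * (a + 3) * Γ.verts.card + (5 * (a + 3) + 6) * Γ.edges.card := hk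
      _ ≤ 26 * a * Γ.verts.card + 26 * a * Γ.edges.card :=
        Nat.add_le_add (Nat.mul_le_mul_right _ (by omega)) (Nat.mul_le_mul_right _ (by omega))
      _ = _ := by ring
  refine ⟨hfold, hbound, fun c hc => hbound.trans ?_⟩
  refine Nat.mul_le_mul_right _ ?_
  calc 26 * (Γ.verts.card + Γ.edges.card) ≤ 26 * (Γ.verts.card + c * Γ.verts.card) := by gcongr
    _ = 26 * (c + 1) * Γ.verts.card := by ring
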